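/- Let $(\Omega,\mathcal F)$ be a measurable space equipped with a sequence $(X_n)_{n\ge 1}$ of real-valued random variables, let $S_k=\sum_{i=1}^k X_i$, and let $\overline{\mathcal P}$ be the family of all probability measures $P$ on $(\Omega,\mathcal F)$ under which $(X_n)_{n\ge1}$ is a sequence of i.i.d. integrable random variables with $\mathsf E_P[X_1]=0$. Let $q\in[1,2)$ and let $\mathcal P\subset\overline{\mathcal P}$ be a family for which $X_1$ has a $\mathcal P$-uniformly integrable $q$-th moment, meaning $$\lim_{x\to\infty}\ \sup_{P\in\mathcal P}\mathsf E_P\big[|X_1|^q\,\mathbf 1\{|X_1|^q\ge x\}\big]=0.$$ Then the strong law of large numbers holds uniformly in $\mathcal P$ at the rate $o(n^{1/q-1})$, meaning that for every $\varepsilon>0$, $$\lim_{m\to\infty}\ \sup_{P\in\mathcal P}P\Big[\sup_{k\ge m}\frac{|S_k|}{k^{1/q}}\ge\varepsilon\Big]=0.$$ -/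

import Mathlib

open Filter Topology MeasureTheory ProbabilityTheory
open scoped ENNReal

noncomputable section

namespace UniformSLLN

variable {Ω : Type*} [MeasurableSpace Ω]

/-- The family of all probability measures on `Ω` under which the process `X` is a sequence of
i.i.d. integrable random variables with expected value zero. The process is indexed from `0`,
so `X 0` is the first random variable, `X 1` the second one, and so on. -/
def iidMeanZero (X : ℕ → Ω → ℝ) : Set (Measure Ω) :=
  {P | IsProbabilityMeasure P ∧ iIndepFun X P ∧ (∀ n, IdentDistrib (X n) (X 0) P P) ∧
    (∀ n, Integrable (X n) P) ∧ ∀ n, ∫ ω, X n ω ∂P = 0}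

/-- The truncated `q`-th absolute moment `E_P[|Y|^q 1{|Y|^q ≥ x}]`, with values in `[0, ∞]`. -/
def truncMoment (P : Measure Ω) (Y : Ω → ℝ) (q x : ℝ) : ℝ≥0∞ :=
  ∫⁻ ω, {ω | x ≤ |Y ω| ^ q}.indicator (fun ω => ENNReal.ofReal (|Y ω| ^ q)) ω ∂P

/-- `Y` has a uniformly integrable `q`-th moment over the family `Ps`. -/
def UniformlyIntegrableMoment (Ps : Set (Measure Ω)) (Y : Ω → ℝ) (q : ℝ) : Prop :=
  Tendsto (fun x : ℝ => ⨆ P ∈ Ps, truncMoment P Y q x) atTop (𝓝 0)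

/-- The sum of the first `k` terms of the process. -/
def partialSum (X : ℕ → Ω → ℝ) (k : ℕ) (ω : Ω) : ℝ :=
  ∑ i ∈ Finset.range k, X i ω

/-- The event `{sup_{k ≥ m} |S_k| / k^{1/q} ≥ ε}`; the supremum is taken in the extended reals
and may be infinite. -/
def tailEvent (X : ℕ → Ω → ℝ) (q ε : ℝ) (m : ℕ) : Set Ω :=
  {ω | (ε : EReal) ≤ ⨆ k ≥ m, ((|partialSum X k ω| / (k : ℝ) ^ (1 / q) : ℝ) : EReal)}

end UniformSLLN

end

namespace UniformSLLN

/-! Split the indices k into dyadic blocks 2^l ≤ k < 2^(l+1). On a block, truncate at |x|^q ≤ 2^l. A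
large |S_k| forces either a term beyond the truncation level (union bound) or a large centred
truncated sum (`kolmogorov_maximal_ineq`); recentring is harmless because mean zero and small tail
moments make the truncated mean small. So `measure_block_le` bounds the block's probability by the
expectation of one explicit function of u = |X₀|^q. These functions are summed over l ≥ j pointwise
in u, before integrating. With s = 2/q > 1, the sum is at most a constant times u·1{u ≥ K}, plus a
constant times |K|^s·2^((1-s)j), whenever K ≤ 2^j. The constants depend only on q and ε, so uniform
integrability fixes K for all measures at once, and then j → ∞ removes the second term. -/

/-! ### Kolmogorov's inequality via Doob's -/

/-- The filtration generated by the terms of `Y` with index below `n`. -/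
def pastFiltration {Ω : Type*} [MeasurableSpace Ω] (Y : ℕ → Ω → ℝ)
    (hY : ∀ n, Measurable (Y n)) : Filtration ℕ (inferInstance : MeasurableSpace Ω) where
  seq n := MeasurableSpace.comap (fun ω (j : Finset.range n) => Y j ω) inferInstance
  mono' m n hmn := by
    have h : Measurable (fun (x : Finset.range n → ℝ) (j : Finset.range m) =>
        x ⟨j, Finset.range_mono hmn j.2⟩) := by fun_prop
    rintro _ ⟨T, hT, rfl⟩
    exact ⟨_, h hT, rfl⟩
  le' n := by
    have : Measurable (fun ω (j : Finset.range n) => Y j ω) := by fun_prop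
    exact this.comap_le

lemma submartingale_sq_partialSum {Ω : Type*} [MeasurableSpace Ω] {P : Measure Ω}
    [IsProbabilityMeasure P] {Y : ℕ → Ω → ℝ} (hY : ∀ n, Measurable (Y n))
    (hind : iIndepFun Y P) (hL2 : ∀ n, MemLp (Y n) 2 P) (hmean : ∀ n, ∫ ω, Y n ω ∂P = 0) :
    Submartingale (fun n ω => partialSum Y n ω ^ 2) (pastFiltration Y hY) P := by
  have hSL2 : ∀ n, MemLp (partialSum Y n) 2 P := fun n =>
    memLp_finsetSum (Finset.range n) (fun i _ => hL2 i)
  refine submartingale_of_setIntegral_le_succ ?_ (fun n => (hSL2 n).integrable_sq) ?_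
  · intro n
    have h : Measurable (fun x : Finset.range n → ℝ => (∑ j, x j) ^ 2) := by fun_prop
    have h2 : (fun ω => partialSum Y n ω ^ 2) =
        (fun x : Finset.range n → ℝ => (∑ j, x j) ^ 2) ∘ (fun ω (j : Finset.range n) => Y j ω) := by
      funext ω
      simp only [partialSum, Function.comp_apply]
      rw [← Finset.sum_coe_sort (Finset.range n) (fun i => Y i ω)]
    have h3 : Measurable[pastFiltration Y hY n] (fun ω => partialSum Y n ω ^ 2) := by
      rw [h2]
      exact h.comp (comap_measurable _)
    exact h3.stronglyMeasurable
  · rintro n s ⟨T, hT, rfl⟩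
    set Z : Ω → Finset.range n → ℝ := fun ω j => Y j ω with hZ
    have hZm : Measurable Z := by fun_prop
    have hs : MeasurableSet (Z ⁻¹' T) := hZm hT
    -- The past factor is independent of `Y n`, which has mean zero.
    have hcross : ∫ ω, (Z ⁻¹' T).indicator (partialSum Y n) ω * Y n ω ∂P = 0 := by
      have hi := hind.indepFun_finset (Finset.range n) {n} (by simp) hY
      have hg : Measurable (T.indicator fun x : Finset.range n → ℝ => ∑ j, x j) :=
        Measurable.indicator (by fun_prop) hT
      have hi' := hi.comp hg
        (measurable_pi_apply (⟨n, by simp⟩ : ({n} : Finset ℕ)) : Measurable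
          (fun x : ({n} : Finset ℕ) → ℝ => x ⟨n, by simp⟩))
      have h1 : (T.indicator fun x : Finset.range n → ℝ => ∑ j, x j) ∘
          (fun a (i : Finset.range n) => Y i a) = (Z ⁻¹' T).indicator (partialSum Y n) := by
        funext ω
        simp only [Function.comp_apply, Set.indicator, Set.mem_preimage, partialSum, hZ]
        rw [← Finset.sum_coe_sort (Finset.range n) (fun i => Y i ω)]
        rfl
      rw [h1] at hi'
      have := hi'.integral_fun_mul_eq_mul_integral
        (((hSL2 n).aestronglyMeasurable).indicator hs) (hY n).aestronglyMeasurable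
      simp only [Function.comp_apply, hmean, mul_zero] at this
      exact this
    -- Expand (S_n + Y_n)² and drop Y_n².
    have hle : ∫ ω in Z ⁻¹' T, (partialSum Y n ω ^ 2 + 2 * (partialSum Y n ω * Y n ω)) ∂P ≤
        ∫ ω in Z ⁻¹' T, partialSum Y (n + 1) ω ^ 2 ∂P := by
      refine setIntegral_mono ?_ ?_ ?_
      · exact ((hSL2 n).integrable_sq.add
          (((hSL2 n).integrable_mul (hL2 n)).const_mul 2)).integrableOn
      · exact (hSL2 (n + 1)).integrable_sq.integrableOn
      · intro ω
        simp only [partialSum, Finset.sum_range_succ]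
        nlinarith [sq_nonneg (Y n ω)]
    refine le_trans (le_of_eq ?_) hle
    have hmul : Integrable (fun ω => 2 * (partialSum Y n ω * Y n ω)) P :=
      ((hSL2 n).integrable_mul (hL2 n)).const_mul 2
    rw [integral_add (hSL2 n).integrable_sq.integrableOn hmul.integrableOn, integral_const_mul,
      ← integral_indicator hs (f := fun ω => partialSum Y n ω * Y n ω)]
    have h4 : (Z ⁻¹' T).indicator (fun ω => partialSum Y n ω * Y n ω) =
        fun ω => (Z ⁻¹' T).indicator (partialSum Y n) ω * Y n ω := by
      funext ω
      by_cases h : ω ∈ Z ⁻¹' T <;> simp [h]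
    rw [h4, hcross]
    simp

/-- **Kolmogorov's maximal inequality.** -/
lemma kolmogorov_maximal_ineq {Ω : Type*} [MeasurableSpace Ω] {P : Measure Ω}
    [IsProbabilityMeasure P] {Y : ℕ → Ω → ℝ} (hY : ∀ n, Measurable (Y n))
    (hind : iIndepFun Y P) (hL2 : ∀ n, MemLp (Y n) 2 P) (hmean : ∀ n, ∫ ω, Y n ω ∂P = 0)
    (n : ℕ) {c : ℝ} (hc : 0 < c) :
    P {ω | ∃ k ≤ n, c ≤ |partialSum Y k ω|} ≤
      ENNReal.ofReal ((∑ i ∈ Finset.range n, ∫ ω, Y i ω ^ 2 ∂P) / c ^ 2) := by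
  have hsub := submartingale_sq_partialSum hY hind hL2 hmean
  have hmax := maximal_ineq hsub (fun k ω => sq_nonneg _) (ε := (c ^ 2).toNNReal) n
  have hset : {ω | (((c ^ 2).toNNReal : NNReal) : ℝ) ≤ (Finset.range (n + 1)).sup'
      Finset.nonempty_range_add_one fun k => partialSum Y k ω ^ 2} =
      {ω | ∃ k ≤ n, c ≤ |partialSum Y k ω|} := by
    ext ω
    simp only [Real.coe_toNNReal _ (sq_nonneg c), Set.mem_ofPred_eq, Finset.le_sup'_iff, Finset.mem_range,
      Nat.lt_succ_iff]
    refine exists_congr fun k => and_congr_right fun _ => ?_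
    rw [sq_le_sq, abs_of_pos hc]
  rw [hset] at hmax
  have hSL2 : MemLp (partialSum Y n) 2 P :=
    memLp_finsetSum (Finset.range n) (fun i _ => hL2 i)
  have hvar : ∫ ω, partialSum Y n ω ^ 2 ∂P = ∑ i ∈ Finset.range n, ∫ ω, Y i ω ^ 2 ∂P := by
    have h := IndepFun.variance_sum (μ := P) (X := Y) (s := Finset.range n) (fun i _ => hL2 i)
      (fun i _ j _ hij => hind.indepFun hij)
    have h0 : (∑ i ∈ Finset.range n, Y i) = partialSum Y n := by
      funext ω; simp [partialSum]
    rw [h0, variance_of_integral_eq_zero hSL2.aemeasurable] at h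
    · rw [h]
      exact Finset.sum_congr rfl fun i _ =>
        variance_of_integral_eq_zero (hL2 i).aemeasurable (hmean i)
    · simp only [partialSum]
      rw [integral_finsetSum _ fun i _ => (hL2 i).integrable one_le_two]
      simp [hmean]
  have hle : ∫ ω in {ω | ∃ k ≤ n, c ≤ |partialSum Y k ω|}, partialSum Y n ω ^ 2 ∂P ≤
      ∑ i ∈ Finset.range n, ∫ ω, Y i ω ^ 2 ∂P := by
    rw [← hvar]
    exact setIntegral_le_integral hSL2.integrable_sq (ae_of_all _ fun ω => sq_nonneg _)
  rw [ENNReal.ofReal_div_of_pos (by positivity), ENNReal.le_div_iff_mul_le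
    (Or.inl (by simp; positivity)) (Or.inl ENNReal.ofReal_ne_top), mul_comm]
  exact hmax.trans (ENNReal.ofReal_le_ofReal hle)

/-! ### Pointwise summation over dyadic blocks -/

/-- The integrand, as a function of `u = |X₀|^q`, that bounds the probability of a large deviation
of the partial sums on the dyadic block of exponent `j`. -/
noncomputable def blockBound (s C : ℝ) (j : ℕ) (u : ℝ) : ℝ :=
  if 2 ^ j < u then 2 * 2 ^ j else C * (u ^ s * (2 ^ (1 - s)) ^ j)

/-- A bound for the sum of `blockBound` over all blocks of exponent at least `j`. -/
noncomputable def blockPotential (s C : ℝ) (j : ℕ) (u : ℝ) : ℝ :=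
  if 2 ^ j < u then 4 * u - 2 * 2 ^ j + C / (1 - 2 ^ (1 - s)) * u
  else C / (1 - 2 ^ (1 - s)) * (u ^ s * (2 ^ (1 - s)) ^ j)

lemma two_rpow_one_sub_lt_one {s : ℝ} (hs : 1 < s) : (2 : ℝ) ^ (1 - s) < 1 :=
  Real.rpow_lt_one_of_one_lt_of_neg one_lt_two (by linarith)

/-- The left side is u·(u/2^j)^(s-1) when u > 0. -/
lemma rpow_mul_two_rpow_le {s : ℝ} (hs : 1 < s) {j : ℕ} {u : ℝ} (hu : 0 ≤ u) (hj : u ≤ 2 ^ j) :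
    u ^ s * ((2 : ℝ) ^ (1 - s)) ^ j ≤ u := by
  rcases hu.eq_or_lt with rfl | hu
  · simp [Real.zero_rpow (by linarith : s ≠ 0)]
  have h1 : ((2 : ℝ) ^ (1 - s)) ^ j = ((2 : ℝ) ^ j) ^ (1 - s) := by
    rw [← Real.rpow_mul_natCast (by norm_num), mul_comm, Real.rpow_natCast_mul (by norm_num)]
  have h2 : ((2 : ℝ) ^ j) ^ (1 - s) ≤ u ^ (1 - s) :=
    Real.rpow_le_rpow_of_nonpos hu hj (by linarith)
  calc u ^ s * ((2 : ℝ) ^ (1 - s)) ^ j ≤ u ^ s * u ^ (1 - s) := by rw [h1]; gcongr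
    _ = u := by rw [← Real.rpow_add hu]; simp

lemma blockPotential_nonneg {s C : ℝ} (hs : 1 < s) (hC : 0 ≤ C) (j : ℕ) {u : ℝ} (hu : 0 ≤ u) :
    0 ≤ blockPotential s C j u := by
  have h1 : 0 ≤ C / (1 - 2 ^ (1 - s)) :=
    div_nonneg hC (sub_nonneg.2 (two_rpow_one_sub_lt_one hs).le)
  unfold blockPotential
  split_ifs
  · have := mul_nonneg h1 hu
    linarith
  · positivity

/-- Telescoping step. The terms 2·2^i with i ≥ j and 2^i < u total at most 4u - 2·2^j; the remaining
terms form a geometric series of ratio 2^(1-s), at most a constant times u at its start. -/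
lemma blockBound_add_blockPotential_succ_le {s C : ℝ} (hs : 1 < s) (hC : 0 ≤ C) (j : ℕ) {u : ℝ}
    (hu : 0 ≤ u) : blockBound s C j u + blockPotential s C (j + 1) u ≤ blockPotential s C j u := by
  have hρ : 0 < 1 - (2 : ℝ) ^ (1 - s) := sub_pos.2 (two_rpow_one_sub_lt_one hs)
  have h1 : 0 ≤ C / (1 - 2 ^ (1 - s)) := div_nonneg hC hρ.le
  have h2 : (2 : ℝ) ^ (j + 1) = 2 * 2 ^ j := by ring
  have h3 : (0 : ℝ) < 2 ^ j := by positivity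
  unfold blockBound blockPotential
  by_cases ha : 2 ^ j < u
  · by_cases hb : 2 ^ (j + 1) < u
    · rw [if_pos ha, if_pos ha, if_pos hb]
      linarith
    · rw [if_pos ha, if_pos ha, if_neg hb]
      have := mul_le_mul_of_nonneg_left (rpow_mul_two_rpow_le hs hu (not_lt.1 hb)) h1
      linarith
  · have hb : ¬ 2 ^ (j + 1) < u := by linarith
    rw [if_neg ha, if_neg ha, if_neg hb]
    apply le_of_eq
    field_simp
    ring

lemma sum_blockBound_le_blockPotential {s C : ℝ} (hs : 1 < s) (hC : 0 ≤ C) {u : ℝ} (hu : 0 ≤ u)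
    (n : ℕ) : ∀ j, ∑ i ∈ Finset.range n, blockBound s C (j + i) u ≤ blockPotential s C j u := by
  induction n with
  | zero => intro j; simpa using blockPotential_nonneg hs hC j hu
  | succ n ih =>
    intro j
    rw [Finset.sum_range_succ']
    have h := ih (j + 1)
    have h2 := blockBound_add_blockPotential_succ_le hs hC j hu
    simp only [add_zero, add_assoc, add_comm 1] at h ⊢
    linarith

lemma blockPotential_le {s C : ℝ} (hs : 1 < s) (hC : 0 ≤ C) {j : ℕ} {u K : ℝ} (hu : 0 ≤ u)
    (hK : K ≤ 2 ^ j) :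
    blockPotential s C j u ≤ (4 + C / (1 - 2 ^ (1 - s))) * (if K ≤ u then u else 0) +
      C / (1 - 2 ^ (1 - s)) * (|K| ^ s * (2 ^ (1 - s)) ^ j) := by
  have hρ : 0 < 1 - (2 : ℝ) ^ (1 - s) := sub_pos.2 (two_rpow_one_sub_lt_one hs)
  have h1 : 0 ≤ C / (1 - 2 ^ (1 - s)) := div_nonneg hC hρ.le
  have h3 : (0 : ℝ) < 2 ^ j := by positivity
  have h4 : 0 ≤ C / (1 - 2 ^ (1 - s)) * (|K| ^ s * (2 ^ (1 - s)) ^ j) := by positivity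
  unfold blockPotential
  by_cases ha : 2 ^ j < u
  · rw [if_pos ha, if_pos (by linarith)]
    linarith
  · rw [if_neg ha]
    by_cases hb : K ≤ u
    · rw [if_pos hb]
      have := mul_le_mul_of_nonneg_left (rpow_mul_two_rpow_le hs hu (not_lt.1 ha)) h1
      linarith
    · rw [if_neg hb, mul_zero, zero_add]
      have : u ≤ |K| := (not_le.1 hb).le.trans (le_abs_self K)
      gcongr

lemma blockBound_nonneg {s C : ℝ} (hC : 0 ≤ C) (j : ℕ) {u : ℝ} (hu : 0 ≤ u) :
    0 ≤ blockBound s C j u := by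
  unfold blockBound
  split_ifs <;> positivity

lemma measurable_blockBound (s C : ℝ) (j : ℕ) : Measurable (blockBound s C j) :=
  Measurable.ite measurableSet_Ioi (by fun_prop) (by fun_prop)

/-! ### Truncation and a single block -/

/-- Truncation of `x` at the level `|x|^q ≤ t`. -/
noncomputable def trunc (q t x : ℝ) : ℝ := if |x| ^ q ≤ t then x else 0

lemma measurable_trunc (q t : ℝ) : Measurable (trunc q t) :=
  Measurable.ite (measurableSet_le (by fun_prop) measurable_const) measurable_id measurable_const

lemma abs_trunc_le {q t : ℝ} (hq : 1 ≤ q) (ht : 0 < t) (x : ℝ) : |trunc q t x| ≤ t ^ (1 / q) := by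
  unfold trunc
  split_ifs with h
  · rw [one_div]
    exact (Real.le_rpow_inv_iff_of_pos (abs_nonneg x) ht.le (by linarith)).2 h
  · simp only [abs_zero]; positivity

lemma abs_le_of_lt_rpow {q t : ℝ} (hq : 1 ≤ q) (ht : 0 < t) {x : ℝ} (hx : t < |x| ^ q) :
    |x| ≤ t ^ (1 / q) / t * |x| ^ q := by
  have hq0 : 0 < q := by linarith
  have hx0 : 0 < |x| := by
    rcases (abs_nonneg x).eq_or_lt with h | h
    · rw [← h, Real.zero_rpow hq0.ne'] at hx; linarith
    · exact h
  have h1 : t ^ (1 / q) ≤ |x| := by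
    rw [one_div]
    exact (Real.rpow_inv_le_iff_of_pos ht.le hx0.le hq0).2 hx.le
  have ha : 0 < t ^ (1 / q) := by positivity
  have h2 : |x| ^ (1 - q) ≤ (t ^ (1 / q)) ^ (1 - q) :=
    Real.rpow_le_rpow_of_nonpos ha h1 (by linarith)
  have h3 : (t ^ (1 / q)) ^ (1 - q) = t ^ (1 / q) / t := by
    rw [Real.rpow_sub ha, Real.rpow_one, ← Real.rpow_mul ht.le, one_div_mul_cancel hq0.ne',
      Real.rpow_one]
  calc |x| = |x| ^ (1 - q) * |x| ^ q := by rw [← Real.rpow_add hx0]; simp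
    _ ≤ _ := by rw [← h3]; gcongr

/-- As Y has mean zero, the truncated mean is minus the mean of the discarded part, where |Y| ≤
t^(1/q-1)·|Y|^q because q ≥ 1. -/
lemma abs_integral_trunc_le {Ω : Type*} [MeasurableSpace Ω] {P : Measure Ω} [IsProbabilityMeasure P] {Y : Ω → ℝ}
    (hY : Measurable Y) (hint : Integrable Y P) (hmean : ∫ ω, Y ω ∂P = 0) {q t c : ℝ}
    (hq : 1 ≤ q) (ht : 0 < t) (hc : 0 ≤ c) (htrunc : truncMoment P Y q t ≤ ENNReal.ofReal c) :
    |∫ ω, trunc q t (Y ω) ∂P| ≤ t ^ (1 / q) / t * c := by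
  have ha : 0 ≤ t ^ (1 / q) / t := by positivity
  have hti : Integrable (fun ω => trunc q t (Y ω)) P :=
    Integrable.of_bound ((measurable_trunc q t).comp hY).aestronglyMeasurable (t ^ (1 / q))
      (ae_of_all _ fun ω => abs_trunc_le hq ht _)
  have h1 : ∫ ω, trunc q t (Y ω) ∂P = ∫ ω, (trunc q t (Y ω) - Y ω) ∂P := by
    rw [integral_sub hti hint, hmean, sub_zero]
  rw [h1, ← ENNReal.ofReal_le_ofReal_iff (by positivity), ← Real.norm_eq_abs]
  calc ENNReal.ofReal ‖∫ ω, (trunc q t (Y ω) - Y ω) ∂P‖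
      ≤ ∫⁻ ω, ENNReal.ofReal ‖trunc q t (Y ω) - Y ω‖ ∂P := by
        simpa only [ofReal_norm] using enorm_integral_le_lintegral_enorm _
    _ ≤ ∫⁻ ω, ENNReal.ofReal (t ^ (1 / q) / t) * {ω | t ≤ |Y ω| ^ q}.indicator
          (fun ω => ENNReal.ofReal (|Y ω| ^ q)) ω ∂P := by
        refine lintegral_mono fun ω => ?_
        unfold trunc
        by_cases h : |Y ω| ^ q ≤ t
        · simp [h]
        · have h' := not_le.1 h
          rw [if_neg h, Set.indicator_of_mem (by exact h'.le), ← ENNReal.ofReal_mul ha, zero_sub,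
            norm_neg]
          exact ENNReal.ofReal_le_ofReal (abs_le_of_lt_rpow hq ht h')
    _ = ENNReal.ofReal (t ^ (1 / q) / t) * truncMoment P Y q t := by
        rw [lintegral_const_mul' _ _ ENNReal.ofReal_ne_top, truncMoment]
    _ ≤ _ := by rw [ENNReal.ofReal_mul ha]; gcongr

lemma measure_exists_lt_rpow_le {Ω : Type*} [MeasurableSpace Ω] {P : Measure Ω} {X : ℕ → Ω → ℝ}
    (hident : ∀ n, IdentDistrib (X n) (X 0) P P) (q t : ℝ) (n : ℕ) :
    P {ω | ∃ i < n, t < |X i ω| ^ q} ≤ n * P {ω | t < |X 0 ω| ^ q} := by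
  have h1 : {ω | ∃ i < n, t < |X i ω| ^ q} = ⋃ i ∈ Finset.range n, {ω | t < |X i ω| ^ q} := by
    ext ω; simp
  rw [h1]
  refine (measure_biUnion_finset_le _ _).trans ?_
  have hm : MeasurableSet {x : ℝ | t < |x| ^ q} :=
    measurableSet_lt measurable_const (by fun_prop)
  have h2 : ∀ i ∈ Finset.range n, P {ω | t < |X i ω| ^ q} = P {ω | t < |X 0 ω| ^ q} :=
    fun i _ => (hident i).measure_mem_eq hm
  rw [Finset.sum_congr rfl h2]
  simp

lemma measure_exists_sum_trunc_le {Ω : Type*} [MeasurableSpace Ω] {P : Measure Ω} {X : ℕ → Ω → ℝ}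
    (hX : ∀ n, Measurable (X n)) (hP : P ∈ iidMeanZero X) {q t c : ℝ} (hq : 1 ≤ q) (ht : 0 < t)
    (hc : 0 < c) (n : ℕ) :
    P {ω | ∃ k ≤ n, c ≤ |partialSum
        (fun i ω => trunc q t (X i ω) - ∫ ω, trunc q t (X 0 ω) ∂P) k ω|} ≤
      ENNReal.ofReal (n / c ^ 2) * ∫⁻ ω, ENNReal.ofReal (trunc q t (X 0 ω) ^ 2) ∂P := by
  obtain ⟨_, hind, hident, hint, hmean⟩ := hP
  set b := ∫ ω, trunc q t (X 0 ω) ∂P with hb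
  have hm : Measurable fun x => trunc q t x - b := (measurable_trunc q t).sub_const b
  have hL2' : ∀ n, MemLp (fun ω => trunc q t (X n ω)) 2 P := fun n =>
    MemLp.of_bound ((measurable_trunc q t).comp (hX n)).aestronglyMeasurable (t ^ (1 / q))
      (ae_of_all _ fun ω => abs_trunc_le hq ht _)
  have hL2 : ∀ n, MemLp (fun ω => trunc q t (X n ω) - b) 2 P := fun n =>
    (hL2' n).sub (memLp_const b)
  have hid : ∀ n, IdentDistrib (fun ω => trunc q t (X n ω) - b)
      (fun ω => trunc q t (X 0 ω) - b) P P := fun n => (hident n).comp hm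
  have h0 : ∫ ω, (trunc q t (X 0 ω) - b) ∂P = 0 := by
    rw [integral_sub ((hL2' 0).integrable one_le_two) (integrable_const b)]
    simp [hb]
  have hk := kolmogorov_maximal_ineq (P := P) (fun n => hm.comp (hX n))
    (hind.comp (fun _ => fun x => trunc q t x - b) (fun _ => hm)) hL2
    (fun n => (hid n).integral_eq.trans h0) n hc
  refine hk.trans ?_
  have hsq : ∀ i ∈ Finset.range n, ∫ ω, (trunc q t (X i ω) - b) ^ 2 ∂P =
      ∫ ω, (trunc q t (X 0 ω) - b) ^ 2 ∂P := fun i _ =>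
    ((hid i).comp (u := fun x => x ^ 2) (by fun_prop)).integral_eq
  have hvar : ∫ ω, (trunc q t (X 0 ω) - b) ^ 2 ∂P ≤ ∫ ω, trunc q t (X 0 ω) ^ 2 ∂P := by
    rw [← variance_eq_integral (hL2' 0).aemeasurable]
    exact variance_le_expectation_sq (hL2' 0).aestronglyMeasurable
  rw [← ofReal_integral_eq_lintegral_ofReal (hL2' 0).integrable_sq
    (ae_of_all _ fun ω => sq_nonneg _), ← ENNReal.ofReal_mul (by positivity)]
  refine ENNReal.ofReal_le_ofReal ?_
  simp only [Function.comp_apply]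
  rw [Finset.sum_congr rfl hsq, Finset.sum_const, Finset.card_range, nsmul_eq_mul, mul_div_right_comm]
  gcongr

/-- If no term is truncated, centring shifts S_k by k·b, which costs at most half the threshold. -/
lemma exists_of_le_abs_partialSum {Ω : Type*} {X : ℕ → Ω → ℝ} {q t a c b : ℝ} {n : ℕ} {ω : Ω}
    (hb : n * |b| ≤ c * a / 2) (h : ∃ k ≤ n, c * a ≤ |partialSum X k ω|) :
    (∃ i < n, t < |X i ω| ^ q) ∨
      ∃ k ≤ n, c * a / 2 ≤ |partialSum (fun i ω => trunc q t (X i ω) - b) k ω| := by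
  by_cases hex : ∃ i < n, t < |X i ω| ^ q
  · exact Or.inl hex
  push Not at hex
  obtain ⟨k, hk, hle⟩ := h
  refine Or.inr ⟨k, hk, ?_⟩
  have h1 : partialSum (fun i ω => trunc q t (X i ω) - b) k ω = partialSum X k ω - k * b := by
    simp only [partialSum, Finset.sum_sub_distrib, Finset.sum_const, Finset.card_range,
      nsmul_eq_mul]
    congr 1
    refine Finset.sum_congr rfl fun i hi => ?_
    rw [trunc, if_pos (hex i (by simp at hi; omega))]
  have h2 : |(k : ℝ) * b| ≤ n * |b| := by
    rw [abs_mul, Nat.abs_cast]; gcongr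
  rw [h1]
  have := abs_sub_abs_le_abs_sub (partialSum X k ω) (k * b)
  linarith

/-- Matches the union and Kolmogorov bounds with `blockBound`: the 8 is the block length factor 2
times 4 from the squared half threshold. -/
lemma blockBound_eq {q c : ℝ} (hq : 1 ≤ q) (hc : 0 < c) (j : ℕ) (x : ℝ) :
    ENNReal.ofReal (blockBound (2 / q) (8 / c ^ 2) j (|x| ^ q)) =
      (2 ^ (j + 1) : ℕ) * {x : ℝ | 2 ^ j < |x| ^ q}.indicator 1 x +
      ENNReal.ofReal ((2 ^ (j + 1) : ℕ) / (c * ((2 : ℝ) ^ j) ^ (1 / q) / 2) ^ 2) *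
        ENNReal.ofReal (trunc q (2 ^ j) x ^ 2) := by
  unfold blockBound trunc
  have hq0 : 0 < q := by linarith
  by_cases h : 2 ^ j < |x| ^ q
  · rw [if_pos h, if_neg (not_le.2 h), Set.indicator_of_mem (by exact h)]
    simp only [Pi.one_apply, mul_one, ne_eq, OfNat.ofNat_ne_zero, not_false_eq_true, zero_pow,
      ENNReal.ofReal_zero, mul_zero, add_zero]
    rw [← ENNReal.ofReal_natCast]
    congr 1
    push_cast
    ring
  · rw [if_neg h, if_pos (not_lt.1 h), Set.indicator_of_notMem (by exact h), mul_zero, zero_add,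
      ← ENNReal.ofReal_mul (by positivity)]
    congr 1
    have h1 : (|x| ^ q) ^ (2 / q) = x ^ 2 := by
      rw [← Real.rpow_mul (abs_nonneg x), mul_div_cancel₀ _ hq0.ne', Real.rpow_two, sq_abs]
    have h2 : (((2 : ℝ) ^ j) ^ (1 / q)) ^ 2 = ((2 : ℝ) ^ j) ^ (2 / q) := by
      rw [← Real.rpow_two, ← Real.rpow_mul (by positivity)]
      congr 1; ring
    have h3 : ((2 : ℝ) ^ (1 - 2 / q)) ^ j = 2 ^ j / ((2 : ℝ) ^ j) ^ (2 / q) := by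
      rw [← Real.rpow_mul_natCast (by norm_num), mul_comm, Real.rpow_natCast_mul (by norm_num),
        Real.rpow_sub (by positivity), Real.rpow_one]
    have h4 : 0 < ((2 : ℝ) ^ j) ^ (2 / q) := by positivity
    rw [h1, h3, div_pow, mul_pow, h2]
    push_cast
    field_simp
    ring

lemma measure_block_le {Ω : Type*} [MeasurableSpace Ω] {P : Measure Ω} {X : ℕ → Ω → ℝ}
    (hX : ∀ n, Measurable (X n)) (hP : P ∈ iidMeanZero X) {q c : ℝ} (hq : 1 ≤ q)
    (hc : 0 < c) (j : ℕ) (htrunc : truncMoment P (X 0) q (2 ^ j) ≤ ENNReal.ofReal (c / 4)) :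
    P {ω | ∃ k ≤ 2 ^ (j + 1), c * ((2 : ℝ) ^ j) ^ (1 / q) ≤ |partialSum X k ω|} ≤
      ∫⁻ ω, ENNReal.ofReal (blockBound (2 / q) (8 / c ^ 2) j (|X 0 ω| ^ q)) ∂P := by
  have hprob : IsProbabilityMeasure P := hP.1
  have ht : (0 : ℝ) < 2 ^ j := by positivity
  have ha : (0 : ℝ) < ((2 : ℝ) ^ j) ^ (1 / q) := by positivity
  have hb : ((2 ^ (j + 1) : ℕ) : ℝ) * |∫ ω, trunc q (2 ^ j) (X 0 ω) ∂P| ≤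
      c * ((2 : ℝ) ^ j) ^ (1 / q) / 2 := by
    -- The tail bound c/4 makes 2^(j+1) times the truncated mean exactly half the threshold.
    have h := abs_integral_trunc_le (hX 0) (hP.2.2.2.1 0) (hP.2.2.2.2 0) hq ht
      (by positivity) htrunc
    calc ((2 ^ (j + 1) : ℕ) : ℝ) * |∫ ω, trunc q (2 ^ j) (X 0 ω) ∂P|
        ≤ ((2 ^ (j + 1) : ℕ) : ℝ) * (((2 : ℝ) ^ j) ^ (1 / q) / 2 ^ j * (c / 4)) := by gcongr
      _ = _ := by push_cast; field_simp; ring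
  refine (measure_mono fun ω hω => exists_of_le_abs_partialSum (q := q) (t := 2 ^ j) hb hω).trans
    ((measure_union_le _ _).trans ((add_le_add (measure_exists_lt_rpow_le hP.2.2.1 q (2 ^ j) _)
      (measure_exists_sum_trunc_le hX hP hq ht (by positivity) _)).trans_eq ?_))
  have hm : MeasurableSet {x : ℝ | 2 ^ j < |x| ^ q} :=
    measurableSet_lt measurable_const (by fun_prop)
  simp_rw [blockBound_eq hq hc]
  rw [lintegral_add_left, lintegral_const_mul' _ _ (ENNReal.natCast_ne_top _),
    lintegral_const_mul' _ _ ENNReal.ofReal_ne_top]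
  · congr 2
    exact (lintegral_indicator_one (hX 0 hm)).symm
  · exact ((measurable_one.indicator hm).comp (hX 0)).const_mul _

/-! ### From blocks to the tail event -/

lemma tailEvent_subset_iUnion {Ω : Type*} (X : ℕ → Ω → ℝ) {q ε : ℝ} (hq : 1 ≤ q) (hε : 0 < ε)
    {j m : ℕ} (hm : 2 ^ j ≤ m) :
    tailEvent X q ε m ⊆ ⋃ i, {ω | ∃ k ≤ 2 ^ (j + i + 1),
      ε / 2 * ((2 : ℝ) ^ (j + i)) ^ (1 / q) ≤ |partialSum X k ω|} := by
  intro ω hω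
  -- The supremum need not be attained; halving ε gives a strict inequality and hence a witness k.
  have hlt : ((ε / 2 : ℝ) : EReal) <
      ⨆ k ≥ m, ((|partialSum X k ω| / (k : ℝ) ^ (1 / q) : ℝ) : EReal) :=
    lt_of_lt_of_le (EReal.coe_lt_coe_iff.2 (by linarith)) hω
  simp only [lt_iSup_iff, EReal.coe_lt_coe_iff] at hlt
  obtain ⟨k, hk, hlt⟩ := hlt
  have hjk : 2 ^ j ≤ k := hm.trans hk
  have hk0 : k ≠ 0 := ((pow_pos two_pos j).trans_le hjk).ne'
  have hjl : j ≤ Nat.log 2 k := Nat.le_log_of_pow_le one_lt_two hjk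
  refine Set.mem_iUnion.2 ⟨Nat.log 2 k - j, k, ?_, ?_⟩
  · rw [Nat.add_sub_cancel' hjl]
    exact (Nat.lt_pow_succ_log_self one_lt_two k).le
  · rw [Nat.add_sub_cancel' hjl]
    have h1 : (2 : ℝ) ^ Nat.log 2 k ≤ k := by exact_mod_cast Nat.pow_log_le_self 2 hk0
    have hkpos : (0 : ℝ) < k := by exact_mod_cast Nat.pos_of_ne_zero hk0
    have h2 : ((2 : ℝ) ^ Nat.log 2 k) ^ (1 / q) ≤ (k : ℝ) ^ (1 / q) :=
      Real.rpow_le_rpow (by positivity) h1 (by positivity)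
    have h3 := (lt_div_iff₀ (by positivity)).1 hlt
    have := mul_le_mul_of_nonneg_left h2 (by positivity : 0 ≤ ε / 2)
    linarith

lemma tsum_ofReal_blockBound_le {s C : ℝ} (hs : 1 < s) (hC : 0 ≤ C) {j : ℕ} {u K : ℝ}
    (hu : 0 ≤ u) (hK : K ≤ 2 ^ j) :
    ∑' i, ENNReal.ofReal (blockBound s C (j + i) u) ≤
      ENNReal.ofReal (4 + C / (1 - 2 ^ (1 - s))) * ENNReal.ofReal (if K ≤ u then u else 0) +
      ENNReal.ofReal (C / (1 - 2 ^ (1 - s)) * (|K| ^ s * (2 ^ (1 - s)) ^ j)) := by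
  have hρ : 0 < 1 - (2 : ℝ) ^ (1 - s) := sub_pos.2 (two_rpow_one_sub_lt_one hs)
  have h1 : 0 ≤ C / (1 - 2 ^ (1 - s)) := div_nonneg hC hρ.le
  refine ENNReal.tsum_le_of_sum_range_le fun n => ?_
  rw [← ENNReal.ofReal_sum_of_nonneg fun i _ => blockBound_nonneg hC _ hu,
    ← ENNReal.ofReal_mul (by positivity),
    ← ENNReal.ofReal_add (mul_nonneg (by positivity) (by split_ifs <;> simp [hu])) (by positivity)]
  exact ENNReal.ofReal_le_ofReal
    ((sum_blockBound_le_blockPotential hs hC hu n j).trans (blockPotential_le hs hC hu hK))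

lemma measure_tailEvent_le {Ω : Type*} [MeasurableSpace Ω] {P : Measure Ω} {X : ℕ → Ω → ℝ}
    (hX : ∀ n, Measurable (X n)) (hP : P ∈ iidMeanZero X) {q ε K : ℝ} (hq : 1 ≤ q) (hq2 : q < 2)
    (hε : 0 < ε) {j m : ℕ} (hm : 2 ^ j ≤ m) (hK : K ≤ 2 ^ j)
    (htrunc : ∀ i, truncMoment P (X 0) q (2 ^ (j + i)) ≤ ENNReal.ofReal (ε / 2 / 4)) :
    P (tailEvent X q ε m) ≤
      ENNReal.ofReal (4 + 8 / (ε / 2) ^ 2 / (1 - 2 ^ (1 - 2 / q))) * truncMoment P (X 0) q K +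
      ENNReal.ofReal (8 / (ε / 2) ^ 2 / (1 - 2 ^ (1 - 2 / q)) *
        (|K| ^ (2 / q) * (2 ^ (1 - 2 / q)) ^ j)) := by
  have hprob : IsProbabilityMeasure P := hP.1
  have hs : 1 < 2 / q := by rw [lt_div_iff₀ (by linarith)]; linarith
  have hU : Measurable fun ω => |X 0 ω| ^ q := by have := hX 0; fun_prop
  calc P (tailEvent X q ε m)
      ≤ ∑' i, ∫⁻ ω, ENNReal.ofReal (blockBound (2 / q) (8 / (ε / 2) ^ 2) (j + i)
          (|X 0 ω| ^ q)) ∂P :=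
        (measure_mono (tailEvent_subset_iUnion X hq hε hm)).trans ((measure_iUnion_le _).trans
          (ENNReal.tsum_le_tsum fun i => measure_block_le hX hP hq (half_pos hε) _ (htrunc i)))
    _ = ∫⁻ ω, ∑' i, ENNReal.ofReal (blockBound (2 / q) (8 / (ε / 2) ^ 2) (j + i)
          (|X 0 ω| ^ q)) ∂P :=
        (lintegral_tsum fun i =>
          ((measurable_blockBound _ _ _).comp hU).ennreal_ofReal.aemeasurable).symm
    _ ≤ ∫⁻ ω, (ENNReal.ofReal (4 + 8 / (ε / 2) ^ 2 / (1 - 2 ^ (1 - 2 / q))) *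
          {ω | K ≤ |X 0 ω| ^ q}.indicator (fun ω => ENNReal.ofReal (|X 0 ω| ^ q)) ω +
          ENNReal.ofReal (8 / (ε / 2) ^ 2 / (1 - 2 ^ (1 - 2 / q)) *
            (|K| ^ (2 / q) * (2 ^ (1 - 2 / q)) ^ j))) ∂P := by
        refine lintegral_mono fun ω => (tsum_ofReal_blockBound_le hs (by positivity)
          (by positivity) hK).trans_eq ?_
        by_cases h : K ≤ |X 0 ω| ^ q <;> simp [h]
    _ = _ := by
        rw [lintegral_add_right _ measurable_const,
          lintegral_const_mul' _ _ ENNReal.ofReal_ne_top, lintegral_const, measure_univ, mul_one,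
          truncMoment]

end UniformSLLN

theorem mainTheorem9 {Ω : Type*} [MeasurableSpace Ω] (X : ℕ → Ω → ℝ)
    (hX : ∀ n, Measurable (X n)) (q : ℝ) (hq1 : 1 ≤ q) (hq2 : q < 2)
    (Ps : Set (Measure Ω)) (hPs : Ps ⊆ UniformSLLN.iidMeanZero X)
    (hUI : UniformSLLN.UniformlyIntegrableMoment Ps (X 0) q) :
    ∀ ε : ℝ, 0 < ε →
      Tendsto (fun m : ℕ => ⨆ P ∈ Ps, P (UniformSLLN.tailEvent X q ε m)) atTop (𝓝 0) := by
  intro ε hε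
  rw [ENNReal.tendsto_nhds_zero]
  intro δ hδ
  have hUI' := ENNReal.tendsto_nhds_zero.1 hUI
  have hs : 1 < 2 / q := by rw [lt_div_iff₀ (by linarith)]; linarith
  have hδ2 : 0 < δ / 2 := ENNReal.half_pos hδ.ne'
  set A := 4 + 8 / (ε / 2) ^ 2 / (1 - (2 : ℝ) ^ (1 - 2 / q))
  set B := 8 / (ε / 2) ^ 2 / (1 - (2 : ℝ) ^ (1 - 2 / q))
  -- K makes the tail-moment term at most δ/2; L keeps the recentring small on every block; j,
  -- chosen last, handles the geometric term.
  obtain ⟨K, hK⟩ := (hUI' (δ / 2 / ENNReal.ofReal A)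
    (ENNReal.div_pos hδ2.ne' ENNReal.ofReal_ne_top)).exists
  obtain ⟨L, hL⟩ := eventually_atTop.1 (hUI' (ENNReal.ofReal (ε / 2 / 4)) (by simpa using hε))
  have hpow : Tendsto (fun j : ℕ => (2 : ℝ) ^ j) atTop atTop :=
    tendsto_pow_atTop_atTop_of_one_lt one_lt_two
  have hgeom : Tendsto (fun j : ℕ =>
      ENNReal.ofReal (B * (|K| ^ (2 / q) * ((2 : ℝ) ^ (1 - 2 / q)) ^ j))) atTop (𝓝 0) := by
    have h := (tendsto_pow_atTop_nhds_zero_of_lt_one (by positivity)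
      (UniformSLLN.two_rpow_one_sub_lt_one hs)).const_mul (|K| ^ (2 / q))
    simpa using ENNReal.tendsto_ofReal (h.const_mul B)
  obtain ⟨j, hjK, hjL, hjB⟩ := ((hpow.eventually_ge_atTop K).and
    ((hpow.eventually_ge_atTop L).and (ENNReal.tendsto_nhds_zero.1 hgeom _ hδ2))).exists
  filter_upwards [eventually_ge_atTop (2 ^ j)] with m hm
  refine iSup₂_le fun P hP => ?_
  refine (UniformSLLN.measure_tailEvent_le hX (hPs hP) hq1 hq2 hε hm hjK fun i => ?_).trans ?_
  · exact (le_iSup₂ (f := fun P (_ : P ∈ Ps) => UniformSLLN.truncMoment P (X 0) q (2 ^ (j + i)))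
      P hP).trans (hL _ (hjL.trans (pow_le_pow_right₀ one_le_two (Nat.le_add_right j i))))
  · rw [← ENNReal.add_halves δ]
    refine add_le_add ?_ hjB
    have hKP := (le_iSup₂ (f := fun P (_ : P ∈ Ps) => UniformSLLN.truncMoment P (X 0) q K)
      P hP).trans hK
    exact (mul_le_mul_right hKP _).trans ENNReal.mul_div_le
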